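/- Let $S=\{s_1,\dots,s_d\}$ be a finite alphabet and let $E=\{w_{i,1}=w_{i,2}\}_{i=1}^r$ be a finite system of equations between words over $S^{\pm}$. For $\overline\sigma\in\mathrm{Sym}(n)^d$ (throughout $n\ge 1$) write $w(\overline\sigma)$ for the permutation obtained from the word $w$ by substituting $s_j\mapsto\sigma_j$. Let $d^{\mathrm H}(\sigma,\tau)=\frac1n|\{x:\sigma x\ne\tau x\}|$, $$\mathrm{SOL}_E(n)=\{\overline\sigma: w_{i,1}(\overline\sigma)=w_{i,2}(\overline\sigma)\ \forall i\},\qquad \mathrm{SOL}_E^{\ge\varepsilon}(n)=\Big\{\overline\sigma:\sum_{j=1}^d d^{\mathrm H}(\sigma_j,\tau_j)\ge\varepsilon\ \ \forall\,\overline\tau\in\mathrm{SOL}_E(n)\Big\}.$$ *Testability.* $E$ is testable if for every $\varepsilon>0$ there are $q\in\mathbb N$ (not depending on $n$) and a randomized query algorithm (a randomized oracle machine, with no restriction on its computation between queries) which, given $n$ and oracle access to the entries of $\sigma_1^{\pm1},\dots,\sigma_d^{\pm1}\in\mathrm{Sym}(n)$, makes at most $q$ (adaptive) queries, accepts with probability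 at least $0.99$ if $\overline\sigma\in\mathrm{SOL}_E(n)$, and rejects with probability at least $0.99$ if $\overline\sigma\in\mathrm{SOL}_E^{\ge\varepsilon}(n)$. *Statistical distinguishability.* Let $F_S$ be the free group on $S$. For a finite $P\subset F_S$ let $N_{\overline\sigma,P}$ be the distribution of $\{w\in P: w(\overline\sigma)x=x\}$ for uniformly random $x\in[n]$. $E$ is statistically distinguishable if for every $\varepsilon>0$ there are a finite $P\subset F_S$ and $\delta>0$ such that $d_{\mathrm{TV}}(N_{\overline\sigma,P},N_{\overline\tau,P})\ge\delta$ for all $n$, all $\overline\sigma\in\mathrm{SOL}_E(n)$ and all $\overline\tau\in\mathrm{SOL}_E^{\ge\varepsilon}(n)$. *Property $(\tau)$.* Let $\Gamma(E)=\langle S\mid E\rangle$. For $\overline\sigma\in\mathrm{Sym}(n)^d$ let $G_{\overline\sigma}$ be the graph on $[n]$ with an edge from $x$ to $\sigma_ix$ for all $x\in[n]$, $1\le i\le d$; connectedness disregards orientation. Let $$\alpha(G_{\overline\sigma})=\min\Big\{\tfrac{1}{|A|}\sum_{i=1}^d|(\sigma_iA)\setminus A| : \emptyset\ne A\subset[n],\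 |A|\le \tfrac n2\Big\}$$ (with $\min\emptyset=\infty$). $\Gamma(E)$ has property $(\tau)$ if the infimum $\alpha(E)$ of $\alpha(G_{\overline\sigma})$, over all $n\ge1$ and all $\overline\sigma\in\mathrm{SOL}_E(n)$ such that $G_{\overline\sigma}$ is connected, is positive. **Theorem.** If $\Gamma(E)$ has property $(\tau)$ and has finite quotient groups of unbounded cardinality (for every $N$ there is a finite quotient of $\Gamma(E)$ with more than $N$ elements), then $E$ is not testable, and $E$ is not statistically distinguishable. -/

import Mathlib

open scoped ENNReal

noncomputable section

namespace PermEq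

/-! ## Systems of equations in permutations -/

/-- Words over `S^±`, where `S = {s_1, …, s_d}` is indexed by `Fin d`: the letter `(i, true)` is
`s_i` and `(i, false)` is its formal inverse (the convention of `FreeGroup.mk`). -/
abbrev Word (d : ℕ) : Type := List (Fin d × Bool)

/-- A (finite) system of equations `w₁ = w₂` between words over `S^±`. -/
abbrev EqSystem (d : ℕ) : Type := Finset (Word d × Word d)

/-- Tuples of `d` permutations of an `n`-point set. -/
abbrev Tuple (d n : ℕ) : Type := Fin d → Equiv.Perm (Fin n)

/-- `w(σ)`: substitute `s_i ↦ σ_i` in the word `w` (the leftmost letter is applied last). -/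
def Word.eval {d n : ℕ} (w : Word d) (σ : Tuple d n) : Equiv.Perm (Fin n) :=
  (w.map fun a => if a.2 then σ a.1 else (σ a.1)⁻¹).prod

/-- `SOL_E(n)`: the solutions of `E` in `Sym(n)^d`. -/
def Sol {d : ℕ} (E : EqSystem d) (n : ℕ) : Set (Tuple d n) :=
  {σ | ∀ e ∈ E, e.1.eval σ = e.2.eval σ}

/-- The normalized Hamming distance on `Sym(n)`. -/
def hamming {n : ℕ} (σ τ : Equiv.Perm (Fin n)) : ℝ :=
  ((Finset.univ.filter fun x => σ x ≠ τ x).card : ℝ) / n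

/-- `SOL_E^{≥ ε}(n)`: the tuples at distance at least `ε` from every solution of `E`. -/
def SolFar {d : ℕ} (E : EqSystem d) (ε : ℝ) (n : ℕ) : Set (Tuple d n) :=
  {σ | ∀ τ ∈ Sol E n, ε ≤ ∑ j, hamming (σ j) (τ j)}

/-! ## Randomized query algorithms and testability -/

/-- Deterministic oracle machines on inputs in `Sym(n)^d`, presented by the tree of their queries.
A machine either halts with an answer (`true` is "accept"), or queries one entry `σ_i x`
(`forward = true`) or `σ_i⁻¹ x` (`forward = false`) and continues according to the reply.
No bound is put on the computation between the queries. -/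
inductive QueryTree (d n : ℕ) : Type
  | answer (accept : Bool) : QueryTree d n
  | query (i : Fin d) (forward : Bool) (x : Fin n) (next : Fin n → QueryTree d n) : QueryTree d n

/-- The reply to a query. -/
def reply {d n : ℕ} (σ : Tuple d n) (i : Fin d) (forward : Bool) (x : Fin n) : Fin n :=
  if forward then σ i x else (σ i)⁻¹ x

/-- The answer of a deterministic machine on the input `σ`. -/
def QueryTree.run {d n : ℕ} (σ : Tuple d n) : QueryTree d n → Bool
  | .answer b => b
  | .query i forward x next => (next (reply σ i forward x)).run σ

/-- The number of queries that a deterministic machine makes on the input `σ`. -/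
def QueryTree.numQueries {d n : ℕ} (σ : Tuple d n) : QueryTree d n → ℕ
  | .answer _ => 0
  | .query i forward x next => (next (reply σ i forward x)).numQueries σ + 1

/-- A randomized oracle machine: given `n`, it is a probability distribution over deterministic
machines for inputs in `Sym(n)^d`. -/
abbrev Machine (d : ℕ) : Type := (n : ℕ) → PMF (QueryTree d n)

/-- The probability that `M`, on the input `(n, σ)`, gives the answer `b`. -/
def Machine.prob {d : ℕ} (M : Machine d) {n : ℕ} (σ : Tuple d n) (b : Bool) : ℝ≥0∞ :=
  ((M n).map fun t => t.run σ) b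

/-- `(ε, q)`-testers for `E`. -/
structure IsTester {d : ℕ} (E : EqSystem d) (ε : ℝ) (q : ℕ) (M : Machine d) : Prop where
  completeness : ∀ n : ℕ, 0 < n → ∀ σ ∈ Sol E n, 99 / 100 ≤ M.prob σ true
  soundness : ∀ n : ℕ, 0 < n → ∀ σ ∈ SolFar E ε n, 99 / 100 ≤ M.prob σ false
  query_efficiency : ∀ n : ℕ, 0 < n → ∀ t ∈ (M n).support, ∀ σ : Tuple d n, t.numQueries σ ≤ q

/-- `E` is testable. -/
def Testable {d : ℕ} (E : EqSystem d) : Prop :=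
  ∀ ε : ℝ, 0 < ε → ∃ q : ℕ, ∃ M : Machine d, IsTester E ε q M

/-! ## Statistical distinguishability -/

/-- `stab_σ(x) ∩ P`, the words of `P` (elements of the free group) that fix `x`. -/
def stabIn {d n : ℕ} (σ : Tuple d n) (P : Finset (FreeGroup (Fin d))) (x : Fin n) :
    Finset (FreeGroup (Fin d)) :=
  P.filter fun w => FreeGroup.lift σ w x = x

/-- `N_{σ,P}`, the distribution of `stab_σ(x) ∩ P` for uniform `x`, as a mass function on the
subsets `Q` of `P`. -/
def localStat {d n : ℕ} (σ : Tuple d n) (P Q : Finset (FreeGroup (Fin d))) : ℝ :=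
  ((Finset.univ.filter fun x => stabIn σ P x = Q).card : ℝ) / n

/-- The total-variation distance of `N_{σ,P}` and `N_{τ,P}`. -/
def localDist {d n : ℕ} (P : Finset (FreeGroup (Fin d))) (σ τ : Tuple d n) : ℝ :=
  (1 / 2) * ∑ Q ∈ P.powerset, |localStat σ P Q - localStat τ P Q|

/-- `E` is statistically distinguishable. -/
def StatDistinguishable {d : ℕ} (E : EqSystem d) : Prop :=
  ∀ ε : ℝ, 0 < ε → ∃ P : Finset (FreeGroup (Fin d)), ∃ δ : ℝ, 0 < δ ∧
    ∀ n : ℕ, 0 < n → ∀ σ ∈ Sol E n, ∀ τ ∈ SolFar E ε n, δ ≤ localDist P σ τ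

/-! ## The group `Γ(E)` and property `(τ)` -/

/-- `R_E`: the relators `w₁ w₂⁻¹`. -/
def relators {d : ℕ} (E : EqSystem d) : Set (FreeGroup (Fin d)) :=
  {r | ∃ e ∈ E, r = FreeGroup.mk e.1 * (FreeGroup.mk e.2)⁻¹}

/-- `Γ(E) = ⟨S | E⟩`. -/
abbrev Gam {d : ℕ} (E : EqSystem d) : Type := PresentedGroup (relators E)

/-- The graph `G_σ` with an edge from `x` to `σ_i x` for all `x` and `i`, with orientation, labels
and loops forgotten; it is used for connectedness only. -/
def graph {d n : ℕ} (σ : Tuple d n) : SimpleGraph (Fin n) :=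
  SimpleGraph.fromRel fun x y => ∃ i, σ i x = y

/-- The Cheeger constant of `G_σ`: the infimum of `(∑_s |sA ∖ A|) / |A|` over the nonempty sets `A`
of at most half of the vertices (`∞` if there is no such `A`, i.e. on one vertex). -/
def cheeger {d n : ℕ} (σ : Tuple d n) : ℝ≥0∞ :=
  ⨅ (A : Finset (Fin n)) (_ : A.Nonempty) (_ : 2 * A.card ≤ n),
    ((∑ i, (A.image (σ i) \ A).card : ℕ) : ℝ≥0∞) / (A.card : ℝ≥0∞)

/-- `α(E)`: the infimum of the Cheeger constants of the connected solutions of `E`. -/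
def alpha {d : ℕ} (E : EqSystem d) : ℝ≥0∞ :=
  ⨅ (n : ℕ) (_ : 0 < n) (σ : Tuple d n) (_ : σ ∈ Sol E n) (_ : (graph σ).Connected), cheeger σ

/-- The group `Γ(E)` has property `(τ)`: its finite connected Schreier graphs are expanders. -/
def PropertyTau {d : ℕ} (E : EqSystem d) : Prop := 0 < alpha E

/-- The group `Γ` has finite quotients of unbounded cardinality. -/
def UnboundedFiniteQuotients (Γ : Type*) [Group Γ] : Prop :=
  ∀ N : ℕ, ∃ K : Subgroup Γ, K.Normal ∧ Finite (Γ ⧸ K) ∧ N < Nat.card (Γ ⧸ K)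

end PermEq

end

/-!
Write `F` for the free group on the generators, so that solutions of `E` are the finite actions of
`F` on which the relators act trivially, and let `α = alpha E > 0`.

*Expansion forbids actions that are slightly too small.* Let `X` be a transitive and `Y` an
arbitrary solution with `|Y| < |X|`, and let `f : Y → X` be any map. Its graph `A ⊆ X × Y` meets
every orbit of `X × Y` in at most half of the points, so expansion of the orbits of `X × Y` gives
`|∂A| ≥ α |A| = α |Y|`; and `|∂A|` counts the failures of equivariance of `f`
(`alpha_mul_card_le_sum_not_equivariant`). Consequently, if one point is removed from a large finite
quotient `X = F / K` of `Γ(E)` and the generators are rerouted around it, the resulting tuple `τ` is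
at distance at least `min α 1 / 2` from all solutions on the same points
(`removePoint_mem_solFar`).

*Such a tuple looks like a solution.* For a given radius `L`, there is a kernel `K₀` of a finite
quotient whose trace on the ball of radius `L` is shared by all smaller kernels `K`. On the points
left in `F / K`, take for `σ` as many copies of the bounded set `F / K₀` as fit, and let the
remaining points be fixed. Then `σ` is a solution, and both `σ` and `τ` look like `F / K₀` up to
radius `L`, off a number of points that does not grow with the size of `K`
(`exists_sol_and_solFar_locally_alike`).

*Neither local statistics nor few queries tell `σ` from `τ`.* The total-variation distance of the
local statistics is at most the proportion of exceptional points (`localDist_le`). For a machine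
with `q` queries, the labels of the points are permuted uniformly at random, which is harmless as
solutions and far tuples are closed under relabelling, and the random labelling is revealed only as
the machine asks for it. With high probability every fresh label falls on an unexceptional vertex
far from those already seen, and then the revealed parts of `σ` and `τ` stay isomorphic
(`acceptsAlike`); so the two acceptance probabilities are nearly equal.
-/

noncomputable section

namespace PermEq

/-! ### Solutions as actions of the free group -/

theorem Word.eval_eq_lift {d n : ℕ} (w : Word d) (σ : Tuple d n) :
    w.eval σ = FreeGroup.lift σ (FreeGroup.mk w) := by
  rw [FreeGroup.lift_mk, Word.eval]
  congr 2
  funext a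
  rcases a with ⟨i, _ | _⟩ <;> rfl

theorem mem_sol_iff {d n : ℕ} {E : EqSystem d} {σ : Tuple d n} :
    σ ∈ Sol E n ↔ ∀ r ∈ relators E, FreeGroup.lift σ r = 1 := by
  constructor
  · rintro h r ⟨e, he, rfl⟩
    rw [map_mul, map_inv, mul_inv_eq_one, ← Word.eval_eq_lift, ← Word.eval_eq_lift]
    exact h e he
  · intro h e he
    have := h _ ⟨e, he, rfl⟩
    rwa [map_mul, map_inv, mul_inv_eq_one, ← Word.eval_eq_lift, ← Word.eval_eq_lift] at this

/-- The tuple by which the free generators act on `Ω`, read on `Fin n` through a numbering of the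
points of `Ω`. -/
def actionTuple {d n : ℕ} {Ω : Type*} [MulAction (FreeGroup (Fin d)) Ω] (e : Ω ≃ Fin n) :
    Tuple d n :=
  fun i => e.permCongr (MulAction.toPerm (FreeGroup.of i))

theorem lift_actionTuple {d n : ℕ} {Ω : Type*} [MulAction (FreeGroup (Fin d)) Ω] (e : Ω ≃ Fin n)
    (w : FreeGroup (Fin d)) (x : Fin n) :
    FreeGroup.lift (actionTuple e) w x = e (w • e.symm x) := by
  have h : FreeGroup.lift (actionTuple e) =
      (e.permCongrHom.toMonoidHom).comp (MulAction.toPermHom (FreeGroup (Fin d)) Ω) := by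
    ext1 i
    simp [actionTuple]
  rw [h]
  rfl

theorem actionTuple_mem_sol {d n : ℕ} {E : EqSystem d} {Ω : Type*}
    [MulAction (FreeGroup (Fin d)) Ω] (e : Ω ≃ Fin n)
    (hrel : ∀ r ∈ relators E, ∀ ω : Ω, r • ω = ω) : actionTuple e ∈ Sol E n := by
  refine mem_sol_iff.2 fun r hr => Equiv.ext fun x => ?_
  simp [lift_actionTuple, hrel r hr]

theorem graph_reachable_lift {d n : ℕ} (σ : Tuple d n) (w : FreeGroup (Fin d)) (x : Fin n) :
    (graph σ).Reachable x (FreeGroup.lift σ w x) := by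
  have hstep : ∀ (i : Fin d) (y : Fin n), (graph σ).Reachable y (σ i y) := fun i y => by
    by_cases h : y = σ i y
    · rw [← h]
    · exact SimpleGraph.Adj.reachable
        ((SimpleGraph.fromRel_adj _ _ _).2 ⟨h, Or.inl ⟨i, rfl⟩⟩)
  induction w using FreeGroup.induction_on generalizing x with
  | C1 => simp
  | of i => simpa using hstep i x
  | inv_of i _ => simpa using (hstep i ((σ i)⁻¹ x)).symm
  | mul v w hv hw =>
    rw [map_mul, Equiv.Perm.mul_apply]
    exact (hw x).trans (hv _)

/-! ### Expansion of the finite actions of `Γ(E)` -/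

open Classical in
/-- The size `∑_i |s_i A ∖ A|` of the boundary of `A` in an action, counted by the points of `A` that
`s_i` moves out of `A`. -/
def boundary (d : ℕ) {Ω : Type*} [MulAction (FreeGroup (Fin d)) Ω] (A : Finset Ω) : ℕ :=
  ∑ i : Fin d, {a ∈ A | FreeGroup.of i • a ∉ A}.card

theorem alpha_mul_card_le_boundary_of_isPretransitive {d : ℕ} (E : EqSystem d) {Ω : Type*}
    [Finite Ω] [MulAction (FreeGroup (Fin d)) Ω] [MulAction.IsPretransitive (FreeGroup (Fin d)) Ω]
    (hrel : ∀ r ∈ relators E, ∀ ω : Ω, r • ω = ω) (A : Finset Ω) (hA : 2 * A.card ≤ Nat.card Ω) :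
    alpha E * A.card ≤ boundary d A := by
  classical
  rcases A.eq_empty_or_nonempty with rfl | hne
  · simp
  obtain ⟨a₀, ha₀⟩ := id hne
  have e : Ω ≃ Fin (Nat.card Ω) := Finite.equivFin Ω
  have hn : 0 < Nat.card Ω := Nat.card_pos_iff.2 ⟨⟨a₀⟩, inferInstance⟩
  have hconn : (graph (actionTuple (d := d) e)).Connected := by
    have : Nonempty (Fin (Nat.card Ω)) := ⟨⟨0, hn⟩⟩
    refine SimpleGraph.Connected.mk fun x y => ?_
    obtain ⟨w, hw⟩ := MulAction.exists_smul_eq (FreeGroup (Fin d)) (e.symm x) (e.symm y)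
    have := graph_reachable_lift (actionTuple e) w x
    rwa [lift_actionTuple, hw, Equiv.apply_symm_apply] at this
  have h1 : alpha E ≤ cheeger (actionTuple (d := d) e) :=
    iInf_le_of_le _ (iInf_le_of_le hn (iInf_le_of_le _ (iInf_le_of_le
      (actionTuple_mem_sol e hrel) (iInf_le_of_le hconn le_rfl))))
  have hcard : (A.map e.toEmbedding).card = A.card := Finset.card_map _
  have h2 : cheeger (actionTuple (d := d) e) ≤ _ :=
    iInf_le_of_le (A.map e.toEmbedding) (iInf_le_of_le (hne.map) (iInf_le_of_le
      (by rw [hcard]; exact hA) le_rfl))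
  have h3 := h1.trans h2
  rw [hcard, ENNReal.le_div_iff_mul_le (by simp [hne.ne_empty]) (by simp)] at h3
  refine h3.trans ?_
  rw [boundary]
  gcongr with i
  calc _ = (((A.filter fun a => FreeGroup.of i • a ∉ A).map
        (MulAction.toPerm (FreeGroup.of i)).toEmbedding).map e.toEmbedding).card := by
        congr 1
        ext x
        simp only [actionTuple, Finset.mem_sdiff, Finset.mem_image, Finset.mem_map,
          Finset.mem_filter, Equiv.coe_toEmbedding, Equiv.permCongr_apply, MulAction.toPerm_apply]
        constructor
        · rintro ⟨⟨_, ⟨a, ha, rfl⟩, rfl⟩, h⟩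
          exact ⟨_, ⟨a, ⟨ha, fun h' => h ⟨_, h', by simp⟩⟩, rfl⟩, by simp⟩
        · rintro ⟨_, ⟨a, ⟨ha, h⟩, rfl⟩, rfl⟩
          refine ⟨⟨_, ⟨a, ha, rfl⟩, by simp⟩, ?_⟩
          rintro ⟨b, hb, hb'⟩
          exact h (e.injective hb' ▸ hb)
    _ ≤ _ := by rw [Finset.card_map, Finset.card_map]

/-- Expansion in a possibly intransitive action, for a set that fills at most half of each orbit. -/
theorem alpha_mul_card_le_boundary {d : ℕ} (E : EqSystem d) {Ω : Type*} [Finite Ω]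
    [MulAction (FreeGroup (Fin d)) Ω] (hrel : ∀ r ∈ relators E, ∀ ω : Ω, r • ω = ω)
    (A : Finset Ω)
    (hA : ∀ ω : Ω, 2 * {a : Ω | a ∈ A ∧ a ∈ MulAction.orbit (FreeGroup (Fin d)) ω}.ncard ≤
      (MulAction.orbit (FreeGroup (Fin d)) ω).ncard) :
    alpha E * A.card ≤ boundary d A := by
  classical
  let F := FreeGroup (Fin d)
  have := Fintype.ofFinite Ω
  let p : Ω → MulAction.orbitRel.Quotient F Ω := Quotient.mk _
  have : Fintype (MulAction.orbitRel.Quotient F Ω) :=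
    Fintype.ofSurjective p Quotient.mk_surjective
  -- the expansion inequality holds on each orbit separately
  have key : ∀ o : MulAction.orbitRel.Quotient F Ω,
      alpha E * ({a ∈ A | p a = o}.card : ℕ) ≤
        (∑ i : Fin d, {a ∈ A | FreeGroup.of i • a ∉ A ∧ p a = o}.card : ℕ) := by
    intro o
    obtain ⟨ω, rfl⟩ : ∃ ω, p ω = o := Quotient.mk_surjective o
    have hmem : ∀ a, p a = p ω ↔ a ∈ MulAction.orbit F ω := fun a => by
      rw [← MulAction.orbitRel_apply]; exact Quotient.eq
    let B := MulAction.orbit F ω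
    let A' : Finset B := Finset.univ.filter fun b => (b : Ω) ∈ A
    have hval : ∀ (Q : Ω → Prop) [DecidablePred Q], (A'.filter fun b : B => Q (b : Ω)).card =
        (A.filter fun a => Q a ∧ p a = p ω).card := by
      intro Q _
      rw [← Finset.card_map (Function.Embedding.subtype (· ∈ B))]
      congr 1
      ext a
      simp only [Finset.mem_map, Finset.mem_filter, A', hmem, Finset.mem_univ, true_and,
        Function.Embedding.subtype_apply, Subtype.exists, exists_and_right, exists_eq_right, B]
      tauto
    have hval' : A'.card = (A.filter fun a => p a = p ω).card := by
      simpa using hval fun _ => True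
    have h := alpha_mul_card_le_boundary_of_isPretransitive E (Ω := B)
      (fun r hr b => Subtype.ext (hrel r hr b)) A' (by
        have := hA ω
        rw [hval', Nat.card_coe_set_eq]
        convert this using 2
        rw [Set.ncard_eq_toFinset_card']
        congr 1
        ext a
        simp [hmem, F])
    rw [hval'] at h
    refine h.trans (le_of_eq ?_)
    rw [boundary]
    congr 1
    refine Finset.sum_congr rfl fun i _ => ?_
    refine Eq.trans (congrArg Finset.card ?_) (hval fun a => FreeGroup.of i • a ∉ A)
    ext b
    simp only [A', Finset.mem_filter, Finset.mem_univ, true_and]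
    rfl
  have h1 : A.card = ∑ o, {a ∈ A | p a = o}.card :=
    Finset.card_eq_sum_card_fiberwise (t := Finset.univ) fun _ _ => by simp
  have h2 : boundary d A = ∑ o, ∑ i : Fin d, {a ∈ A | FreeGroup.of i • a ∉ A ∧ p a = o}.card := by
    rw [boundary, Finset.sum_comm]
    refine Finset.sum_congr rfl fun i _ => ?_
    rw [Finset.card_eq_sum_card_fiberwise (f := p) (t := Finset.univ) fun _ _ => by simp]
    simp only [Finset.filter_filter]
  rw [h1, h2, Nat.cast_sum, Nat.cast_sum, Finset.mul_sum]
  exact Finset.sum_le_sum fun o _ => key o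

/-- A map from a finite action `Y` to a larger transitive action `X` is far from equivariant.

Its graph meets an orbit of `X × Y` in at most half of the points: the intersection injects into an
orbit of `Y`, whose size properly divides the size of the orbit of `X × Y`. Hence expansion applies
to the graph of the map, whose boundary counts the failures of equivariance. -/
theorem alpha_mul_card_le_sum_not_equivariant {d : ℕ} (E : EqSystem d) {X Y : Type*} [Finite X]
    [Fintype Y] [DecidableEq X] [MulAction (FreeGroup (Fin d)) X] [MulAction (FreeGroup (Fin d)) Y]
    [MulAction.IsPretransitive (FreeGroup (Fin d)) X]
    (hX : ∀ r ∈ relators E, ∀ x : X, r • x = x) (hY : ∀ r ∈ relators E, ∀ y : Y, r • y = y)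
    (hcard : Fintype.card Y < Nat.card X) (f : Y → X) :
    alpha E * Fintype.card Y ≤
      (∑ i : Fin d, (Finset.univ.filter fun y : Y =>
        f (FreeGroup.of i • y) ≠ FreeGroup.of i • f y).card : ℕ) := by
  classical
  let F := FreeGroup (Fin d)
  let g : Y ↪ X × Y := ⟨fun y => (f y, y), fun a b h => (Prod.ext_iff.1 h).2⟩
  have h := alpha_mul_card_le_boundary E (Ω := X × Y)
    (fun r hr ω => Prod.ext (hX r hr ω.1) (hY r hr ω.2)) (Finset.univ.map g) (by
      rintro ⟨x, y⟩
      let B := MulAction.orbit F (x, y)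
      let C := MulAction.orbit F y
      have h1 : {a : X × Y | a ∈ Finset.univ.map g ∧ a ∈ B}.ncard ≤ C.ncard := by
        refine Set.ncard_le_ncard_of_injOn Prod.snd ?_ ?_ (Set.toFinite _)
        · rintro a ⟨-, ⟨w, rfl⟩⟩
          exact ⟨w, rfl⟩
        · rintro a ⟨ha, -⟩ b ⟨hb, -⟩ hab
          obtain ⟨y₁, -, rfl⟩ := Finset.mem_map.1 ha
          obtain ⟨y₂, -, rfl⟩ := Finset.mem_map.1 hb
          have : y₁ = y₂ := hab
          rw [this]
      have h2 : C.ncard ∣ B.ncard := by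
        rw [← MulAction.index_stabilizer, ← MulAction.index_stabilizer]
        refine Subgroup.index_dvd_of_le fun w hw => ?_
        exact (Prod.ext_iff.1 (MulAction.mem_stabilizer_iff.1 hw)).2
      have h3 : C.ncard < Nat.card X := by
        refine lt_of_le_of_lt ?_ hcard
        rw [← Nat.card_eq_fintype_card, ← Set.ncard_univ]
        exact Set.ncard_le_ncard (Set.subset_univ _) (Set.toFinite _)
      have h4 : Nat.card X ≤ B.ncard := by
        rw [← Set.ncard_univ]
        have : (Set.univ : Set X) ⊆ Prod.fst '' B := by
          intro x' _
          obtain ⟨w, hw⟩ := MulAction.exists_smul_eq F x x'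
          exact ⟨w • (x, y), ⟨w, rfl⟩, hw⟩
        exact (Set.ncard_le_ncard this (Set.toFinite _)).trans
          (Set.ncard_image_le (Set.toFinite _))
      obtain ⟨k, hk⟩ := h2
      have h5 : 2 ≤ k := by
        by_contra hlt
        have : C.ncard * k ≤ C.ncard * 1 := Nat.mul_le_mul_left _ (by omega)
        omega
      calc _ ≤ 2 * C.ncard := Nat.mul_le_mul_left _ h1
        _ ≤ k * C.ncard := Nat.mul_le_mul_right _ h5
        _ = B.ncard := by rw [hk, mul_comm])
  rw [Finset.card_map, Finset.card_univ] at h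
  refine h.trans (le_of_eq ?_)
  rw [boundary]
  congr 1
  refine Finset.sum_congr rfl fun i _ => ?_
  rw [← Finset.card_map g]
  congr 1
  ext a
  simp only [Finset.mem_filter, Finset.mem_map, Finset.mem_univ, true_and]
  constructor
  · rintro ⟨⟨y, rfl⟩, hy⟩
    exact ⟨y, fun h => hy ⟨FreeGroup.of i • y, Prod.ext h rfl⟩, rfl⟩
  · rintro ⟨y, hy, rfl⟩
    refine ⟨⟨y, rfl⟩, ?_⟩
    rintro ⟨y', hy'⟩
    obtain ⟨h1, h2⟩ := Prod.ext_iff.1 hy'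
    have h2' : y' = FreeGroup.of i • y := h2
    subst h2'
    exact hy h1

/-! ### Kernels of finite quotients of `Γ(E)` -/

/-- `K` is the preimage in the free group of a finite-index normal subgroup of `Γ(E)`. -/
structure IsFiniteQuotientKernel {d : ℕ} (E : EqSystem d) (K : Subgroup (FreeGroup (Fin d))) :
    Prop where
  normal : K.Normal
  finiteIndex : K.FiniteIndex
  relators_subset : relators E ⊆ K

/-- The ball of radius `L` in the free group, for the word norm. -/
def wordBall (d L : ℕ) : Finset (FreeGroup (Fin d)) :=
  Set.Finite.toFinset (s := {w : FreeGroup (Fin d) | w.norm ≤ L})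
    (((List.finite_length_le (Fin d × Bool) L).image FreeGroup.mk).subset
      fun w hw => ⟨w.toWord, hw, FreeGroup.mk_toWord⟩)

theorem mem_wordBall {d L : ℕ} {w : FreeGroup (Fin d)} : w ∈ wordBall d L ↔ w.norm ≤ L := by
  simp [wordBall]

theorem smul_quotient_eq_self_iff {G : Type*} [Group G] {K : Subgroup G} (hK : K.Normal) (w : G)
    (c : G ⧸ K) : w • c = c ↔ w ∈ K := by
  obtain ⟨g, rfl⟩ := QuotientGroup.mk_surjective c
  rw [← QuotientGroup.eq_one_iff w]
  exact mul_eq_right (a := (w : G ⧸ K)) (b := (g : G ⧸ K))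

theorem IsFiniteQuotientKernel.relator_smul {d : ℕ} {E : EqSystem d}
    {K : Subgroup (FreeGroup (Fin d))} (hK : IsFiniteQuotientKernel E K) :
    ∀ r ∈ relators E, ∀ c : FreeGroup (Fin d) ⧸ K, r • c = c :=
  fun _ hr c => (smul_quotient_eq_self_iff hK.normal _ c).2 (hK.relators_subset hr)

/-- On a given ball, the kernels of finite quotients have a smallest trace. This replaces residual
finiteness of `Γ(E)`: the trace is that of the kernel of the residually finite quotient. -/
theorem exists_kernel_with_least_trace {d : ℕ} (E : EqSystem d) (L : ℕ) :
    ∃ K₀, IsFiniteQuotientKernel E K₀ ∧ ∀ K ≤ K₀, IsFiniteQuotientKernel E K →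
      ∀ w : FreeGroup (Fin d), w.norm ≤ L → (w ∈ K ↔ w ∈ K₀) := by
  classical
  let t : Subgroup (FreeGroup (Fin d)) → Finset (FreeGroup (Fin d)) :=
    fun K => (wordBall d L).filter (· ∈ K)
  have htop : IsFiniteQuotientKernel E (⊤ : Subgroup (FreeGroup (Fin d))) :=
    ⟨inferInstance, inferInstance, fun _ _ => trivial⟩
  let S : Set (Subgroup (FreeGroup (Fin d))) := {K | IsFiniteQuotientKernel E K}
  obtain ⟨K₀, hK₀, hmin⟩ : ∃ K₀ ∈ S, ∀ K ∈ S, (t K₀).card ≤ (t K).card := by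
    have hS : S.Nonempty := ⟨⊤, htop⟩
    exact ⟨Function.argminOn (fun K => (t K).card) S hS, Function.argminOn_mem _ _ _,
      fun K hK => Function.argminOn_le (fun K => (t K).card) S hK⟩
  refine ⟨K₀, hK₀, fun K hle hK w hw => ⟨fun h => hle h, fun h => ?_⟩⟩
  have hsub : t K ⊆ t K₀ := Finset.monotone_filter_right _ fun w _ hw => hle hw
  have heq : t K = t K₀ := Finset.eq_of_subset_of_card_le hsub (hmin K hK)
  have : w ∈ t K := by
    rw [heq]
    exact Finset.mem_filter.2 ⟨mem_wordBall.2 hw, h⟩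
  exact (Finset.mem_filter.1 this).2

theorem exists_kernel_le_of_large_index {d : ℕ} {E : EqSystem d}
    (hquot : UnboundedFiniteQuotients (Gam E)) {K₀ : Subgroup (FreeGroup (Fin d))}
    (hK₀ : IsFiniteQuotientKernel E K₀) (N : ℕ) :
    ∃ K ≤ K₀, IsFiniteQuotientKernel E K ∧ N < K.index := by
  obtain ⟨H, hnorm, hfin, hN⟩ := hquot N
  have hsurj := PresentedGroup.mk_surjective (relators E)
  let H' := H.comap (PresentedGroup.mk (relators E))
  have hidx : H'.index = Nat.card (Gam E ⧸ H) := Subgroup.index_comap_of_surjective H hsurj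
  have := hK₀.normal
  have := hK₀.finiteIndex
  have hfi : H'.FiniteIndex := ⟨by omega⟩
  refine ⟨K₀ ⊓ H', inf_le_left, ⟨inferInstance, inferInstance, fun r hr =>
    ⟨hK₀.relators_subset hr, ?_⟩⟩, ?_⟩
  · change PresentedGroup.mk (relators E) r ∈ H
    have : PresentedGroup.mk (relators E) r = 1 :=
      (QuotientGroup.eq_one_iff r).2 (Subgroup.subset_normalClosure hr)
    rw [this]
    exact H.one_mem
  · have : (K₀ ⊓ H').FiniteIndex := inferInstance
    have h := Nat.le_of_dvd (Nat.pos_of_ne_zero this.index_ne_zero)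
      (Subgroup.index_dvd_of_le (inf_le_right : K₀ ⊓ H' ≤ H'))
    omega

/-! ### Tuples that look like a finite quotient -/

/-- The words of norm at most `L` that fix `x` are exactly those that lie in `R`. -/
def LocallyLike {d n : ℕ} (σ : Tuple d n) (R : Set (FreeGroup (Fin d))) (L : ℕ) (x : Fin n) :
    Prop :=
  ∀ w : FreeGroup (Fin d), w.norm ≤ L → (FreeGroup.lift σ w x = x ↔ w ∈ R)

open Classical in
/-- The number of points at which `σ` does not look like `R` up to radius `L`. -/
def exceptional {d n : ℕ} (σ : Tuple d n) (R : Set (FreeGroup (Fin d))) (L : ℕ) : ℕ :=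
  (Finset.univ.filter fun x => ¬ LocallyLike σ R L x).card

/-- Copies of `F / K` and fewer than `|F / K|` fixed points form a solution on any number of
points. -/
theorem exists_sol_exceptional_le {d : ℕ} {E : EqSystem d} {K : Subgroup (FreeGroup (Fin d))}
    (hK : IsFiniteQuotientKernel E K) (L n : ℕ) :
    ∃ σ ∈ Sol E n, exceptional σ K L ≤ K.index := by
  classical
  have := hK.finiteIndex
  let Ω := (Σ _ : Fin (n / K.index), FreeGroup (Fin d) ⧸ K) ⊕
    (Σ _ : Fin (n % K.index), FreeGroup (Fin d) ⧸ (⊤ : Subgroup (FreeGroup (Fin d))))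
  have : Fintype (FreeGroup (Fin d) ⧸ K) := Fintype.ofFinite _
  have : Fintype (FreeGroup (Fin d) ⧸ (⊤ : Subgroup (FreeGroup (Fin d)))) := Fintype.ofFinite _
  have hidx : Fintype.card (FreeGroup (Fin d) ⧸ K) = K.index := by
    rw [← Nat.card_eq_fintype_card]; rfl
  have htop : Fintype.card (FreeGroup (Fin d) ⧸ (⊤ : Subgroup (FreeGroup (Fin d)))) = 1 := by
    rw [← Nat.card_eq_fintype_card]; exact Subgroup.index_top
  have hcard : Fintype.card Ω = n := by
    simp only [Ω, Fintype.card_sum, Fintype.card_sigma, Finset.sum_const, Finset.card_univ,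
      Fintype.card_fin, hidx, htop, smul_eq_mul, mul_one]
    exact Nat.div_add_mod' n K.index
  let e : Ω ≃ Fin n := Fintype.equivFinOfCardEq hcard
  refine ⟨actionTuple e, actionTuple_mem_sol e ?_, ?_⟩
  · rintro r hr (⟨j, c⟩ | ⟨j, c⟩)
    · rw [Sum.smul_inl, Sigma.smul_mk, hK.relator_smul r hr]
    · rw [Sum.smul_inr, Sigma.smul_mk, smul_quotient_eq_self_iff inferInstance r c |>.2 trivial]
  · calc exceptional (actionTuple (d := d) e) (K : Set (FreeGroup (Fin d))) L
        ≤ (Finset.univ.image fun j : Σ _ : Fin (n % K.index),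
            FreeGroup (Fin d) ⧸ (⊤ : Subgroup (FreeGroup (Fin d))) => e (Sum.inr j)).card := by
          refine Finset.card_le_card fun x hx => ?_
          obtain ⟨ω, rfl⟩ := e.surjective x
          rcases ω with ⟨j, c⟩ | j
          · refine absurd (fun w _ => ?_) (Finset.mem_filter.1 hx).2
            rw [lift_actionTuple e, Equiv.symm_apply_apply, e.apply_eq_iff_eq, Sum.smul_inl,
              Sigma.smul_mk, SetLike.mem_coe, ← smul_quotient_eq_self_iff hK.normal w c]
            exact ⟨fun h => eq_of_heq (Sigma.mk.inj (Sum.inl.inj h)).2, fun h => by rw [h]⟩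
          · exact Finset.mem_image_of_mem _ (Finset.mem_univ j)
      _ ≤ n % K.index := by
          refine Finset.card_image_le.trans ?_
          simp [htop]
      _ ≤ K.index := (Nat.mod_lt _ (Nat.pos_of_ne_zero Subgroup.FiniteIndex.index_ne_zero)).le

/-! ### Removing a point from a transitive action -/

/-- The tuple obtained from an action by removing the point `e none`: a generator that would lead
into the removed point goes on to the image of that point. -/
def removePoint {d n : ℕ} {X : Type*} [MulAction (FreeGroup (Fin d)) X] (e : Option (Fin n) ≃ X) :
    Tuple d n :=
  fun i => Equiv.removeNone ((e.trans (MulAction.toPerm (FreeGroup.of i))).trans e.symm)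

theorem removePoint_apply {d n : ℕ} {X : Type*} [MulAction (FreeGroup (Fin d)) X]
    (e : Option (Fin n) ≃ X) (i : Fin d) (y : Fin n)
    (h : FreeGroup.of i • e (some y) ≠ e none) :
    e (some (removePoint e i y)) = FreeGroup.of i • e (some y) := by
  have h' : e.symm (FreeGroup.of i • e (some y)) ≠ none := fun h0 =>
    h (by rw [← h0, Equiv.apply_symm_apply])
  obtain ⟨z, hz⟩ := Option.ne_none_iff_exists'.1 h'
  rw [removePoint, Equiv.removeNone_some _ ⟨z, hz⟩]
  simp

theorem removePoint_inv_apply {d n : ℕ} {X : Type*} [MulAction (FreeGroup (Fin d)) X]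
    (e : Option (Fin n) ≃ X) (i : Fin d) (y : Fin n)
    (h : (FreeGroup.of i)⁻¹ • e (some y) ≠ e none) :
    e (some ((removePoint e i)⁻¹ y)) = (FreeGroup.of i)⁻¹ • e (some y) := by
  have h' : e.symm ((FreeGroup.of i)⁻¹ • e (some y)) ≠ none := fun h0 =>
    h (by rw [← h0, Equiv.apply_symm_apply])
  obtain ⟨z, hz⟩ := Option.ne_none_iff_exists'.1 h'
  have hz' : (FreeGroup.of i)⁻¹ • e (some y) = e (some z) := by
    rw [← hz, Equiv.apply_symm_apply]
  have hy : FreeGroup.of i • e (some z) = e (some y) := by rw [← hz', smul_inv_smul]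
  have h1 := removePoint_apply e i z (by rw [hy]; simp)
  have h2 : removePoint e i z = y := by
    rw [hy] at h1
    exact Option.some_injective _ (e.injective h1)
  rw [hz', ← h2]
  simp

/-- Away from the removed point, short words act as before. -/
theorem lift_removePoint_apply {d n : ℕ} {X : Type*} [MulAction (FreeGroup (Fin d)) X]
    (e : Option (Fin n) ≃ X) (w : FreeGroup (Fin d)) (y : Fin n)
    (h : ∀ v : FreeGroup (Fin d), v.norm ≤ w.norm → v • e (some y) ≠ e none) :
    e (some (FreeGroup.lift (removePoint e) w y)) = w • e (some y) := by
  have key : ∀ l : Word d,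
      (∀ v : FreeGroup (Fin d), v.norm ≤ l.length → v • e (some y) ≠ e none) →
      e (some (FreeGroup.lift (removePoint e) (FreeGroup.mk l) y)) =
        FreeGroup.mk l • e (some y) := by
    intro l
    induction l with
    | nil =>
      intro _
      rw [← FreeGroup.one_eq_mk]
      simp
    | cons a l ih =>
      intro hl
      have ih' := ih fun v hv => hl v (hv.trans (by simp))
      have hne := hl (FreeGroup.mk (a :: l)) FreeGroup.norm_mk_le
      have hcons : FreeGroup.mk (a :: l) = FreeGroup.mk [a] * FreeGroup.mk l := by
        rw [FreeGroup.mul_mk]; rfl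
      rw [hcons, mul_smul, ← ih'] at hne
      rw [hcons, map_mul, Equiv.Perm.mul_apply, mul_smul, ← ih']
      rcases a with ⟨i, _ | _⟩
      · have hi : FreeGroup.mk [(i, false)] = (FreeGroup.of i)⁻¹ := rfl
        rw [hi] at hne ⊢
        rw [map_inv, FreeGroup.lift_apply_of]
        exact removePoint_inv_apply e i _ hne
      · have hi : FreeGroup.mk [(i, true)] = FreeGroup.of i := rfl
        rw [hi] at hne ⊢
        rw [FreeGroup.lift_apply_of]
        exact removePoint_apply e i _ hne
  have := key w.toWord h
  rwa [FreeGroup.mk_toWord] at this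

/-- The exceptional points are among those that a short word moves to the removed point. -/
theorem exceptional_removePoint_le {d n L : ℕ} {K : Subgroup (FreeGroup (Fin d))} (hK : K.Normal)
    (e : Option (Fin n) ≃ FreeGroup (Fin d) ⧸ K) {R : Set (FreeGroup (Fin d))}
    (hR : ∀ w : FreeGroup (Fin d), w.norm ≤ L → (w ∈ K ↔ w ∈ R)) :
    exceptional (removePoint e) R L ≤ (wordBall d L).card := by
  classical
  have hsub : (Finset.univ.filter fun x => ¬ LocallyLike (removePoint e) R L x) ⊆
      (wordBall d L).biUnion fun v => Finset.univ.filter fun y => v • e (some y) = e none := by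
    intro y hy
    by_contra hnot
    refine (Finset.mem_filter.1 hy).2 fun w hw => ?_
    have h : ∀ v : FreeGroup (Fin d), v.norm ≤ w.norm → v • e (some y) ≠ e none :=
      fun v hv h0 => hnot (Finset.mem_biUnion.2
        ⟨v, mem_wordBall.2 (hv.trans hw), Finset.mem_filter.2 ⟨Finset.mem_univ _, h0⟩⟩)
    rw [← hR w hw, ← smul_quotient_eq_self_iff hK w (e (some y)),
      ← lift_removePoint_apply e w y h, e.apply_eq_iff_eq, Option.some_inj]
  refine (Finset.card_le_card hsub).trans (Finset.card_biUnion_le.trans ?_)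
  refine (Finset.sum_le_card_nsmul _ _ 1 fun v _ => ?_).trans (by simp)
  refine Finset.card_le_one.2 fun a ha b hb => ?_
  have h := (Finset.mem_filter.1 ha).2.trans (Finset.mem_filter.1 hb).2.symm
  exact Option.some_injective _ (e.injective (MulAction.injective v h))

/-- Every solution `ρ` on the remaining points differs from `removePoint e` at many of them: the
inclusion `y ↦ e (some y)` fails to be equivariant only there and at one point per generator. -/
theorem alpha_mul_le_of_removePoint {d n : ℕ} {E : EqSystem d} {X : Type*} [Finite X]
    [MulAction (FreeGroup (Fin d)) X] [MulAction.IsPretransitive (FreeGroup (Fin d)) X]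
    (hX : ∀ r ∈ relators E, ∀ x : X, r • x = x) (e : Option (Fin n) ≃ X) {ρ : Tuple d n}
    (hρ : ρ ∈ Sol E n) :
    alpha E * n ≤
      ((∑ i, (Finset.univ.filter fun y => removePoint e i y ≠ ρ i y).card + d : ℕ) : ℝ≥0∞) := by
  classical
  let _ : MulAction (FreeGroup (Fin d)) (Fin n) := MulAction.compHom _ (FreeGroup.lift ρ)
  have hsmul : ∀ (w : FreeGroup (Fin d)) (y : Fin n), w • y = FreeGroup.lift ρ w y :=
    fun _ _ => rfl
  have hcard : Fintype.card (Fin n) < Nat.card X := by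
    rw [← Nat.card_congr e]
    simp
  have h := alpha_mul_card_le_sum_not_equivariant E hX
    (fun r hr y => by rw [hsmul, mem_sol_iff.1 hρ r hr]; rfl) hcard fun y => e (some y)
  rw [Fintype.card_fin] at h
  refine h.trans (Nat.cast_le.2 ?_)
  suffices hi : ∀ i : Fin d, (Finset.univ.filter fun y : Fin n =>
      e (some (FreeGroup.of i • y)) ≠ FreeGroup.of i • e (some y)).card ≤
      (Finset.univ.filter fun y => removePoint e i y ≠ ρ i y).card + 1 by
    refine (Finset.sum_le_sum fun i _ => hi i).trans (le_of_eq ?_)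
    rw [Finset.sum_add_distrib]
    simp
  intro i
  have hsub : (Finset.univ.filter fun y : Fin n =>
      e (some (FreeGroup.of i • y)) ≠ FreeGroup.of i • e (some y)) ⊆
      (Finset.univ.filter fun y => removePoint e i y ≠ ρ i y) ∪
        Finset.univ.filter fun y => FreeGroup.of i • e (some y) = e none := by
    intro y hy
    by_contra hnot
    simp only [Finset.mem_union, Finset.mem_filter, Finset.mem_univ, true_and, not_or,
      not_not] at hnot
    refine (Finset.mem_filter.1 hy).2 ?_
    rw [← removePoint_apply e i y hnot.2, hnot.1, hsmul, FreeGroup.lift_apply_of]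
  refine (Finset.card_le_card hsub).trans ((Finset.card_union_le _ _).trans ?_)
  gcongr
  refine Finset.card_le_one.2 fun a ha b hb => ?_
  have h := (Finset.mem_filter.1 ha).2.trans (Finset.mem_filter.1 hb).2.symm
  exact Option.some_injective _ (e.injective (MulAction.injective _ h))

theorem removePoint_mem_solFar {d n : ℕ} {E : EqSystem d} {X : Type*} [Finite X]
    [MulAction (FreeGroup (Fin d)) X] [MulAction.IsPretransitive (FreeGroup (Fin d)) X]
    (hX : ∀ r ∈ relators E, ∀ x : X, r • x = x) (e : Option (Fin n) ≃ X)
    (hn : 0 < n) (hnd : 2 * d ≤ (min (alpha E) 1).toReal * n) :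
    removePoint e ∈ SolFar E ((min (alpha E) 1).toReal / 2) n := by
  intro ρ hρ
  set a := (min (alpha E) 1).toReal with ha
  have h : min (alpha E) 1 * n ≤ _ :=
    (mul_le_mul_left (min_le_left _ _) _).trans (alpha_mul_le_of_removePoint hX e hρ)
  have h' := ENNReal.toReal_mono (by simp) h
  rw [ENNReal.toReal_mul, ENNReal.toReal_natCast, ENNReal.toReal_natCast, ← ha] at h'
  push_cast at h'
  have hn' : (0 : ℝ) < n := by exact_mod_cast hn
  simp only [hamming]
  rw [← Finset.sum_div, le_div_iff₀ hn']
  linarith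

/-- Under property `(τ)` there are, up to every radius `L`, solutions and far tuples of arbitrarily
large common size that look alike at all but boundedly many points. -/
theorem exists_sol_and_solFar_locally_alike {d : ℕ} {E : EqSystem d} (htau : PropertyTau E)
    (hquot : UnboundedFiniteQuotients (Gam E)) :
    ∃ ε : ℝ, 0 < ε ∧ ∀ L : ℕ, ∃ (R : Set (FreeGroup (Fin d))) (c : ℕ), ∀ n₀ : ℕ,
      ∃ n, n₀ < n ∧ ∃ σ ∈ Sol E n, ∃ τ ∈ SolFar E ε n,
        exceptional σ R L ≤ c ∧ exceptional τ R L ≤ c := by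
  -- the truncation at `1` is there because `alpha E` may be `∞`
  set a := (min (alpha E) 1).toReal with ha
  have hapos : 0 < a := by
    refine ENNReal.toReal_pos (ne_of_gt (lt_min htau (by simp))) ?_
    exact ne_top_of_le_ne_top ENNReal.one_ne_top (min_le_right _ _)
  refine ⟨a / 2, by positivity, fun L => ?_⟩
  obtain ⟨K₀, hK₀, hmin⟩ := exists_kernel_with_least_trace E L
  refine ⟨K₀, max K₀.index (wordBall d L).card, fun n₀ => ?_⟩
  obtain ⟨m, hm⟩ := exists_nat_ge (2 * d / a)
  obtain ⟨K, hle, hK, hidx⟩ := exists_kernel_le_of_large_index hquot hK₀ (n₀ + m + 1)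
  obtain ⟨n, hn⟩ : ∃ n, K.index = n + 1 := ⟨K.index - 1, by omega⟩
  have := hK.finiteIndex
  obtain ⟨e⟩ : Nonempty (Option (Fin n) ≃ FreeGroup (Fin d) ⧸ K) := by
    refine Finite.card_eq.1 ?_
    change Nat.card (Option (Fin n)) = K.index
    rw [hn, Finite.card_option]
    simp
  obtain ⟨σ, hσ, hexc⟩ := exists_sol_exceptional_le hK₀ L n
  refine ⟨n, by omega, σ, hσ, removePoint e, removePoint_mem_solFar hK.relator_smul e (by omega) ?_,
    hexc.trans (le_max_left _ _),
    (exceptional_removePoint_le hK.normal e (hmin K hle hK)).trans (le_max_right _ _)⟩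
  rw [div_le_iff₀ hapos] at hm
  have : (m : ℝ) ≤ n := by exact_mod_cast (by omega : m ≤ n)
  rw [← ha]
  nlinarith

/-! ### Random relabelling and partial labellings -/

/-- The tuple `σ` after relabelling: the label `x` is put on the vertex `ψ x`. -/
def relabel {d n : ℕ} (σ : Tuple d n) (ψ : Equiv.Perm (Fin n)) : Tuple d n :=
  fun i => ψ⁻¹ * σ i * ψ

/-- The element `s_i^{±1}` of the free group that a query asks about. -/
def letter {d : ℕ} (i : Fin d) (forward : Bool) : FreeGroup (Fin d) :=
  if forward then FreeGroup.of i else (FreeGroup.of i)⁻¹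

theorem norm_letter {d : ℕ} (i : Fin d) (forward : Bool) : (letter i forward).norm = 1 := by
  cases forward <;> simp [letter, FreeGroup.norm_inv_eq]

theorem reply_relabel {d n : ℕ} (σ : Tuple d n) (ψ : Equiv.Perm (Fin n)) (i : Fin d)
    (forward : Bool) (x : Fin n) :
    reply (relabel σ ψ) i forward x = ψ⁻¹ (FreeGroup.lift σ (letter i forward) (ψ x)) := by
  cases forward <;> simp [reply, relabel, letter, mul_assoc]

/-- The labellings `ψ` that agree with the partial labelling `φ` on the set `D` of labels. -/
def extensions {n : ℕ} (D : Finset (Fin n)) (φ : Fin n → Fin n) : Finset (Equiv.Perm (Fin n)) :=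
  Finset.univ.filter fun ψ => ∀ x ∈ D, ψ x = φ x

theorem mem_extensions {n : ℕ} {D : Finset (Fin n)} {φ : Fin n → Fin n}
    {ψ : Equiv.Perm (Fin n)} : ψ ∈ extensions D φ ↔ ∀ x ∈ D, ψ x = φ x := by
  simp [extensions]

theorem mem_extensions_insert {n : ℕ} {D : Finset (Fin n)} {φ : Fin n → Fin n} {x u : Fin n}
    (hx : x ∉ D) {ψ : Equiv.Perm (Fin n)} :
    ψ ∈ extensions (insert x D) (Function.update φ x u) ↔ ψ ∈ extensions D φ ∧ ψ x = u := by
  simp only [mem_extensions, Finset.mem_insert, forall_eq_or_imp, Function.update_self]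
  rw [and_comm]
  refine and_congr_left fun _ => forall₂_congr fun y hy => ?_
  rw [Function.update_of_ne (ne_of_mem_of_not_mem hy hx)]

/-- Sorting the extensions by the vertex that carries the label `x`. -/
theorem card_filter_extensions_eq_sum_vertices {n : ℕ} (D : Finset (Fin n)) (φ : Fin n → Fin n)
    {x : Fin n} (hx : x ∉ D) (Q : Equiv.Perm (Fin n) → Prop) [DecidablePred Q] :
    ((extensions D φ).filter Q).card = ∑ u ∈ (D.image φ)ᶜ,
      ((extensions (insert x D) (Function.update φ x u)).filter Q).card := by
  rw [Finset.card_eq_sum_card_fiberwise (f := fun ψ => ψ x) (t := (D.image φ)ᶜ)]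
  · refine Finset.sum_congr rfl fun u _ => congrArg Finset.card ?_
    ext ψ
    simp only [Finset.mem_filter, mem_extensions_insert hx]
    tauto
  · intro ψ hψ
    have hψ' := mem_extensions.1 (Finset.mem_filter.1 hψ).1
    simp only [Finset.coe_compl, Set.mem_compl_iff, Finset.mem_coe, Finset.mem_image, not_exists,
      not_and]
    intro y hy h
    rw [← hψ' y hy] at h
    exact hx (ψ.injective h ▸ hy)

/-- Sorting the extensions by the label of the vertex `z`. -/
theorem card_filter_extensions_eq_sum_labels {n : ℕ} (D : Finset (Fin n)) (φ : Fin n → Fin n)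
    {z : Fin n} (hz : z ∉ D.image φ) (Q : Equiv.Perm (Fin n) → Prop) [DecidablePred Q] :
    ((extensions D φ).filter Q).card = ∑ y ∈ Dᶜ,
      ((extensions (insert y D) (Function.update φ y z)).filter Q).card := by
  rw [Finset.card_eq_sum_card_fiberwise (f := fun ψ => ψ.symm z) (t := Dᶜ)]
  · refine Finset.sum_congr rfl fun y hy => congrArg Finset.card ?_
    ext ψ
    simp only [Finset.mem_filter, mem_extensions_insert (Finset.mem_compl.1 hy),
      Equiv.symm_apply_eq, eq_comm (a := z)]
    tauto
  · intro ψ hψ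
    have hψ' := mem_extensions.1 (Finset.mem_filter.1 hψ).1
    simp only [Finset.coe_compl, Set.mem_compl_iff, Finset.mem_coe]
    intro hy
    exact hz (Finset.mem_image.2 ⟨_, hy, by rw [← hψ' _ hy, Equiv.apply_symm_apply]⟩)

theorem injOn_update_insert {α β : Type*} [DecidableEq α] [DecidableEq β] {D : Finset α}
    {φ : α → β} (hφ : Set.InjOn φ D) {x : α} (hx : x ∉ D) {u : β} (hu : u ∉ D.image φ) :
    Set.InjOn (Function.update φ x u) (insert x D : Finset α) := by
  rw [Finset.coe_insert, Set.injOn_insert (by simpa using hx)]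
  have heq : Set.EqOn (Function.update φ x u) φ D := fun y hy =>
    Function.update_of_ne (ne_of_mem_of_not_mem hy (by simpa using hx)) _ _
  refine ⟨hφ.congr heq.symm, ?_⟩
  rw [heq.image_eq, Function.update_self]
  simpa using hu

theorem card_extensions {n : ℕ} (D : Finset (Fin n)) (φ : Fin n → Fin n) (hφ : Set.InjOn φ D) :
    (extensions D φ).card = (n - D.card).factorial := by
  induction hm : n - D.card generalizing D φ with
  | zero =>
    have hD : D = Finset.univ := by
      rw [← Finset.card_eq_iff_eq_univ, Fintype.card_fin]
      exact le_antisymm (by simpa using D.card_le_univ) (by omega)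
    subst hD
    have hbij : Function.Bijective φ :=
      Finite.injective_iff_bijective.1 (by simpa [Set.injOn_univ] using hφ)
    rw [Nat.factorial_zero, Finset.card_eq_one]
    refine ⟨Equiv.ofBijective φ hbij, Finset.ext fun ψ => ?_⟩
    simp [mem_extensions, Equiv.ext_iff]
  | succ m ih =>
    obtain ⟨x, hx⟩ : ∃ x, x ∉ D := by
      by_contra! h
      have := Finset.card_eq_iff_eq_univ D |>.2 (Finset.eq_univ_iff_forall.2 h)
      rw [Fintype.card_fin] at this
      omega
    have h := card_filter_extensions_eq_sum_vertices D φ hx fun _ => True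
    simp only [Finset.filter_true] at h
    have hcard : ((D.image φ)ᶜ).card = m + 1 := by
      rw [Finset.card_compl, Finset.card_image_of_injOn hφ, Fintype.card_fin, hm]
    rw [h, Nat.factorial_succ, ← hcard]
    refine Finset.sum_const_nat fun u hu =>
      ih _ _ (injOn_update_insert hφ hx (Finset.mem_compl.1 hu)) ?_
    rw [Finset.card_insert_of_notMem hx]
    omega

/-! ### Partial labellings that look alike -/

/-- The partial labellings `φ` of `σ` and `φ'` of `τ` on `D` look alike up to radius `r`: no word of
norm at most `r` tells them apart. -/
def Alike {d n : ℕ} (σ τ : Tuple d n) (D : Finset (Fin n)) (φ φ' : Fin n → Fin n) (r : ℕ) : Prop :=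
  ∀ w : FreeGroup (Fin d), w.norm ≤ r → ∀ x ∈ D, ∀ y ∈ D,
    (FreeGroup.lift σ w (φ x) = φ y ↔ FreeGroup.lift τ w (φ' x) = φ' y)

theorem Alike.mono {d n : ℕ} {σ τ : Tuple d n} {D : Finset (Fin n)} {φ φ' : Fin n → Fin n}
    {r s : ℕ} (h : Alike σ τ D φ φ' s) (hrs : r ≤ s) : Alike σ τ D φ φ' r :=
  fun w hw => h w (hw.trans hrs)

/-- Labelling a neighbour of a labelled vertex costs `2` in the radius: a word between vertices of
the new set is conjugated by letters into one between vertices of the old set. -/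
theorem Alike.insert_neighbor {d n : ℕ} {σ τ : Tuple d n} {D : Finset (Fin n)}
    {φ φ' : Fin n → Fin n} {r : ℕ} (h : Alike σ τ D φ φ' (r + 2)) {x y : Fin n} (hx : x ∈ D)
    (hy : y ∉ D) {g : FreeGroup (Fin d)} (hg : g.norm ≤ 1) :
    Alike σ τ (insert y D) (Function.update φ y (FreeGroup.lift σ g (φ x)))
      (Function.update φ' y (FreeGroup.lift τ g (φ' x))) r := by
  have hrep : ∀ a ∈ insert y D, ∃ v : FreeGroup (Fin d), v.norm ≤ 1 ∧ ∃ b ∈ D,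
      Function.update φ y (FreeGroup.lift σ g (φ x)) a = FreeGroup.lift σ v (φ b) ∧
      Function.update φ' y (FreeGroup.lift τ g (φ' x)) a = FreeGroup.lift τ v (φ' b) := by
    intro a ha
    rcases Finset.mem_insert.1 ha with rfl | ha
    · exact ⟨g, hg, x, hx, by simp, by simp⟩
    · have hne := ne_of_mem_of_not_mem ha hy
      exact ⟨1, by simp, a, ha, by simp [hne], by simp [hne]⟩
  intro w hw a ha b hb
  obtain ⟨u, hu, a', ha', h1, h2⟩ := hrep a ha
  obtain ⟨v, hv, b', hb', h3, h4⟩ := hrep b hb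
  have hnorm : (v⁻¹ * w * u).norm ≤ r + 2 := by
    have e1 := FreeGroup.norm_mul_le (v⁻¹ * w) u
    have e2 := FreeGroup.norm_mul_le v⁻¹ w
    rw [FreeGroup.norm_inv_eq] at e2
    omega
  have key := h _ hnorm a' ha' b' hb'
  simp only [map_mul, map_inv, Equiv.Perm.mul_apply, Equiv.Perm.inv_eq_iff_eq] at key
  rw [h1, h2, h3, h4, key]

/-- The vertices at which a new label makes the partial labelling of `σ` lose its shape: those that
do not look like `R`, and those near a labelled vertex. -/
def unfit {d n : ℕ} (σ : Tuple d n) (R : Set (FreeGroup (Fin d))) (L : ℕ) (D : Finset (Fin n))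
    (φ : Fin n → Fin n) : Set (Fin n) :=
  {u | ¬ LocallyLike σ R L u ∨ ∃ w ∈ wordBall d L, ∃ y ∈ D, FreeGroup.lift σ w (φ y) = u}

theorem ncard_unfit_le {d n : ℕ} (σ : Tuple d n) (R : Set (FreeGroup (Fin d))) (L : ℕ)
    (D : Finset (Fin n)) (φ : Fin n → Fin n) :
    (unfit σ R L D φ).ncard ≤ exceptional σ R L + (wordBall d L).card * D.card := by
  classical
  have hsub : unfit σ R L D φ ⊆
      ((Finset.univ.filter fun x => ¬ LocallyLike σ R L x) ∪
        (wordBall d L ×ˢ D).image fun p => FreeGroup.lift σ p.1 (φ p.2) : Finset (Fin n)) := by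
    rintro u (h | ⟨w, hw, y, hy, h⟩)
    · simp [h]
    · rw [Finset.coe_union]
      exact Or.inr (Finset.mem_coe.2
        (Finset.mem_image.2 ⟨(w, y), Finset.mem_product.2 ⟨hw, hy⟩, h⟩))
  refine (Set.ncard_le_ncard hsub (Finset.finite_toSet _)).trans ?_
  rw [Set.ncard_coe_finset]
  refine (Finset.card_union_le _ _).trans ?_
  unfold exceptional
  gcongr
  exact Finset.card_image_le.trans (by rw [Finset.card_product])

/-- Labelling a fit vertex costs nothing in the radius: the new label is too far from the old ones
for a short word to connect them, and the stabilizers on both sides are read off from `R`. -/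
theorem Alike.insert_fit {d n : ℕ} {σ τ : Tuple d n} {D : Finset (Fin n)}
    {φ φ' : Fin n → Fin n} {r L : ℕ} (h : Alike σ τ D φ φ' r) (hrL : r ≤ L) {x : Fin n}
    (hx : x ∉ D) {R : Set (FreeGroup (Fin d))} {u u' : Fin n} (hu : u ∉ unfit σ R L D φ)
    (hu' : u' ∉ unfit τ R L D φ') :
    Alike σ τ (insert x D) (Function.update φ x u) (Function.update φ' x u') r := by
  simp only [unfit, Set.mem_ofPred_eq, not_or, not_not, not_exists, not_and, mem_wordBall]
    at hu hu'
  intro w hw a ha b hb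
  have hwL := hw.trans hrL
  have hwL' : w⁻¹.norm ≤ L := by rwa [FreeGroup.norm_inv_eq]
  rcases Finset.mem_insert.1 ha with hax | haD <;> rcases Finset.mem_insert.1 hb with hbx | hbD
  · subst hax hbx
    simp only [Function.update_self]
    rw [hu.1 w hwL, hu'.1 w hwL]
  · subst hax
    have hne := ne_of_mem_of_not_mem hbD hx
    have h1 := hu.2 w⁻¹ hwL' b hbD
    have h2 := hu'.2 w⁻¹ hwL' b hbD
    rw [map_inv, Equiv.Perm.inv_eq_iff_eq] at h1 h2
    simp only [Function.update_self, Function.update_of_ne hne]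
    exact ⟨fun h => absurd h.symm h1, fun h => absurd h.symm h2⟩
  · subst hbx
    have hne := ne_of_mem_of_not_mem haD hx
    simp only [Function.update_self, Function.update_of_ne hne]
    exact ⟨fun h => absurd h (hu.2 w hwL a haD), fun h => absurd h (hu'.2 w hwL a haD)⟩
  · have hne := ne_of_mem_of_not_mem haD hx
    have hne' := ne_of_mem_of_not_mem hbD hx
    simp only [Function.update_of_ne hne, Function.update_of_ne hne']
    exact h w hw a haD b hbD

/-! ### Few queries do not tell alike tuples apart -/

/-- The number of extensions of the partial labelling `φ` on `D` for which the machine accepts the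
relabelled tuple. -/
def acceptCount {d n : ℕ} (σ : Tuple d n) (t : QueryTree d n) (D : Finset (Fin n))
    (φ : Fin n → Fin n) : ℕ :=
  ((extensions D φ).filter fun ψ => t.run (relabel σ ψ) = true).card

/-- `t` accepts the random extensions of alike partial labellings of `σ` and `τ` with nearly equal
probabilities: each of the `q` remaining queries contributes at most `η` to the difference. The set
`D` can grow by two labels and the radius shrinks by two with each query. -/
def AcceptsAlike {d n : ℕ} (σ τ : Tuple d n) (Q : ℕ) (η : ℝ) (t : QueryTree d n) : Prop :=
  ∀ (q : ℕ) (D : Finset (Fin n)) (φ φ' : Fin n → Fin n), D.card + 2 * q ≤ 2 * Q →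
    Set.InjOn φ D → Set.InjOn φ' D → Alike σ τ D φ φ' (2 * q) →
    (∀ ψ ∈ extensions D φ, t.numQueries (relabel σ ψ) ≤ q) →
    (acceptCount σ t D φ : ℝ) ≤ acceptCount τ t D φ' + q * η * (n - D.card).factorial

theorem acceptCount_query_of_labelled {d n : ℕ} (σ : Tuple d n) {i : Fin d} {fw : Bool}
    {x y : Fin n} {next : Fin n → QueryTree d n} {D : Finset (Fin n)} {φ : Fin n → Fin n}
    (hx : x ∈ D) (hy : y ∈ D) (hxy : FreeGroup.lift σ (letter i fw) (φ x) = φ y) :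
    acceptCount σ (.query i fw x next) D φ = acceptCount σ (next y) D φ := by
  refine congrArg Finset.card (Finset.filter_congr fun ψ hψ => ?_)
  rw [QueryTree.run, reply_relabel, mem_extensions.1 hψ x hx, hxy, ← mem_extensions.1 hψ y hy,
    Equiv.Perm.inv_eq_iff_eq.2 rfl]

/-- If the queried edge ends at an unlabelled vertex, the reply is the label of that vertex, which is
uniformly distributed over the unused labels. -/
theorem acceptCount_query_of_unlabelled {d n : ℕ} (σ : Tuple d n) {i : Fin d} {fw : Bool}
    {x : Fin n} {next : Fin n → QueryTree d n} {D : Finset (Fin n)} {φ : Fin n → Fin n}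
    (hx : x ∈ D) (hz : FreeGroup.lift σ (letter i fw) (φ x) ∉ D.image φ) :
    acceptCount σ (.query i fw x next) D φ = ∑ y ∈ Dᶜ, acceptCount σ (next y) (insert y D)
      (Function.update φ y (FreeGroup.lift σ (letter i fw) (φ x))) := by
  rw [acceptCount, card_filter_extensions_eq_sum_labels D φ hz]
  refine Finset.sum_congr rfl fun y hy => ?_
  refine congrArg Finset.card (Finset.filter_congr fun ψ hψ => ?_)
  obtain ⟨hψ, hψy⟩ := (mem_extensions_insert (Finset.mem_compl.1 hy)).1 hψ
  rw [QueryTree.run, reply_relabel, mem_extensions.1 hψ x hx, ← hψy,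
    Equiv.Perm.inv_eq_iff_eq.2 rfl]

/-- The case of a query at a vertex that already carries a label. -/
theorem acceptCount_query_le_of_mem {d n : ℕ} {σ τ : Tuple d n} {Q : ℕ} {η : ℝ} (hη : 0 ≤ η)
    {i : Fin d} {fw : Bool} {x : Fin n} {next : Fin n → QueryTree d n}
    (ih : ∀ y, AcceptsAlike σ τ Q η (next y)) {k : ℕ} {D : Finset (Fin n)} {φ φ' : Fin n → Fin n}
    (hD : D.card + 2 * (k + 1) ≤ 2 * Q + 1) (hx : x ∈ D) (hφ : Set.InjOn φ D)
    (hφ' : Set.InjOn φ' D) (halike : Alike σ τ D φ φ' (2 * (k + 1)))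
    (hq : ∀ ψ ∈ extensions D φ,
      (QueryTree.query i fw x next).numQueries (relabel σ ψ) ≤ k + 1) :
    (acceptCount σ (.query i fw x next) D φ : ℝ) ≤
      acceptCount τ (.query i fw x next) D φ' + k * η * (n - D.card).factorial := by
  have hg := norm_letter i fw
  have hiff := fun y hy => halike (letter i fw) (by omega) x hx y hy
  by_cases hz : FreeGroup.lift σ (letter i fw) (φ x) ∈ D.image φ
  · obtain ⟨y, hy, hyz⟩ := Finset.mem_image.1 hz
    rw [acceptCount_query_of_labelled σ hx hy hyz.symm,
      acceptCount_query_of_labelled τ hx hy ((hiff y hy).1 hyz.symm)]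
    refine ih y k D φ φ' (by omega) hφ hφ' (halike.mono (by omega)) fun ψ hψ => ?_
    have h := hq ψ hψ
    rw [QueryTree.numQueries, reply_relabel, mem_extensions.1 hψ x hx, ← hyz,
      ← mem_extensions.1 hψ y hy, Equiv.Perm.inv_eq_iff_eq.2 rfl] at h
    omega
  · have hz' : FreeGroup.lift τ (letter i fw) (φ' x) ∉ D.image φ' := fun h => by
      obtain ⟨y, hy, hyz⟩ := Finset.mem_image.1 h
      exact hz (Finset.mem_image.2 ⟨y, hy, ((hiff y hy).2 hyz.symm).symm⟩)
    rw [acceptCount_query_of_unlabelled σ hx hz, acceptCount_query_of_unlabelled τ hx hz']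
    push_cast
    have hstep : ∀ y ∈ Dᶜ, (acceptCount σ (next y) (insert y D)
          (Function.update φ y (FreeGroup.lift σ (letter i fw) (φ x))) : ℝ) ≤
        acceptCount τ (next y) (insert y D)
          (Function.update φ' y (FreeGroup.lift τ (letter i fw) (φ' x))) +
          k * η * (n - D.card - 1).factorial := by
      intro y hy
      have hy' := Finset.mem_compl.1 hy
      have hc : (insert y D).card = D.card + 1 := Finset.card_insert_of_notMem hy'
      have h := ih y k (insert y D) _ _ (by omega) (injOn_update_insert hφ hy' hz)
        (injOn_update_insert hφ' hy' hz') (halike.insert_neighbor hx hy' hg.le) (by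
          intro ψ hψ
          obtain ⟨hψ, hψy⟩ := (mem_extensions_insert hy').1 hψ
          have h := hq ψ hψ
          rw [QueryTree.numQueries, reply_relabel, mem_extensions.1 hψ x hx, ← hψy,
            Equiv.Perm.inv_eq_iff_eq.2 rfl] at h
          omega)
      rwa [hc, ← Nat.sub_sub] at h
    refine (Finset.sum_le_sum hstep).trans ?_
    rw [Finset.sum_add_distrib, Finset.sum_const, nsmul_eq_mul, Finset.card_compl,
      Fintype.card_fin]
    have hfact : ((n - D.card : ℕ) : ℝ) * (n - D.card - 1).factorial ≤ (n - D.card).factorial := by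
      rcases Nat.eq_zero_or_pos (n - D.card) with h0 | h0
      · simp [h0]
      · exact_mod_cast (Nat.mul_factorial_pred h0.ne').le
    have hkη : 0 ≤ k * η := by positivity
    nlinarith [mul_le_mul_of_nonneg_left hfact hkη]

/-- Comparison of two sums whose terms are comparable off small exceptional sets. -/
theorem sum_le_sum_of_forall_notMem {α : Type*} {S T : Finset α}
    (hST : S.card = T.card) {a b : α → ℝ} {X Y : Set α} (hX : X.Finite)
    (hY : Y.Finite) {F e c : ℝ} (hF : 0 ≤ F) (he : 0 ≤ e) (hXc : X.ncard ≤ c) (hYc : Y.ncard ≤ c)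
    (haF : ∀ u ∈ S, a u ≤ F) (hb : ∀ v ∈ T, 0 ≤ b v)
    (hab : ∀ u ∈ S, ∀ v ∈ T, u ∉ X → v ∉ Y → a u ≤ b v + e) :
    ∑ u ∈ S, a u ≤ ∑ v ∈ T, b v + S.card * e + 2 * c * F := by
  classical
  have hc : 0 ≤ c := (Nat.cast_nonneg _).trans hXc
  have hind : ∀ (U : Finset α) (Z : Set α), Z.Finite → (Z.ncard : ℝ) ≤ c →
      ∑ u ∈ U, (if u ∈ Z then F else 0) ≤ c * F := by
    intro U Z hZ hZc
    rw [← Finset.sum_filter, Finset.sum_const, nsmul_eq_mul]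
    refine mul_le_mul_of_nonneg_right (le_trans ?_ hZc) hF
    rw [← Set.ncard_coe_finset]
    exact_mod_cast Set.ncard_le_ncard (fun u hu => (Finset.mem_filter.1 hu).2) hZ
  rcases S.eq_empty_or_nonempty with rfl | hS
  · have := Finset.sum_nonneg hb
    simp only [Finset.sum_empty, Finset.card_empty, Nat.cast_zero, zero_mul, add_zero]
    positivity
  have hm : (0 : ℝ) < S.card := by exact_mod_cast hS.card_pos
  have h : ∑ u ∈ S, ∑ v ∈ T, a u ≤ ∑ u ∈ S, ∑ v ∈ T,
      (b v + e + (if u ∈ X then F else 0) + (if v ∈ Y then F else 0)) := by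
    refine Finset.sum_le_sum fun u hu => Finset.sum_le_sum fun v hv => ?_
    have h1 := haF u hu
    have h2 := hb v hv
    split_ifs with hx hy hy
    · linarith
    · linarith
    · linarith
    · linarith [hab u hu v hv hx hy]
  simp only [Finset.sum_add_distrib, Finset.sum_const, nsmul_eq_mul, ← Finset.mul_sum, ← hST] at h
  have h1 := hind S X hX hXc
  have h2 := hind T Y hY hYc
  refine le_of_mul_le_mul_left (h.trans ?_) hm
  nlinarith [mul_le_mul_of_nonneg_left h1 hm.le, mul_le_mul_of_nonneg_left h2 hm.le]

/-- Two tuples that look like the same `R` at most points cannot be told apart by few queries: as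
long as every new label falls on a fit vertex, the labelled parts of the two tuples stay alike. -/
theorem acceptsAlike {d n : ℕ} {σ τ : Tuple d n} {R : Set (FreeGroup (Fin d))} {Q c : ℕ} {η : ℝ}
    (hη : 0 ≤ η) (hσ : exceptional σ R (2 * Q) ≤ c) (hτ : exceptional τ R (2 * Q) ≤ c)
    (hn : 2 * ((c + (wordBall d (2 * Q)).card * (2 * Q) : ℕ) : ℝ) ≤ η * (n - 2 * Q))
    (t : QueryTree d n) : AcceptsAlike σ τ Q η t := by
  induction t with
  | answer b =>
    intro q D φ φ' _ hφ hφ' _ _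
    have hcount : acceptCount σ (.answer b) D φ = acceptCount τ (.answer b) D φ' := by
      cases b <;> simp [acceptCount, QueryTree.run, card_extensions, hφ, hφ']
    rw [hcount]
    exact le_add_of_nonneg_right (by positivity)
  | query i fw x next ih =>
    intro q D φ φ' hD hφ hφ' halike hq
    rcases (extensions D φ).eq_empty_or_nonempty with hemp | ⟨ψ, hψ⟩
    · have h0 : acceptCount σ (.query i fw x next) D φ = 0 := by simp [acceptCount, hemp]
      rw [h0, Nat.cast_zero]
      positivity
    obtain ⟨k, rfl⟩ : ∃ k, q = k + 1 := by
      have := hq ψ hψ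
      rw [QueryTree.numQueries] at this
      exact ⟨q - 1, by omega⟩
    by_cases hx : x ∈ D
    · refine (acceptCount_query_le_of_mem hη ih (by omega) hx hφ hφ' halike hq).trans ?_
      push_cast
      gcongr
      linarith
    · set m := n - D.card with hm
      have hDn : D.card < n := by
        have := Finset.card_lt_univ_of_notMem hx
        rwa [Fintype.card_fin] at this
      have hS : ((D.image φ)ᶜ).card = m := by
        rw [Finset.card_compl, Finset.card_image_of_injOn hφ, Fintype.card_fin]
      have hT : ((D.image φ')ᶜ).card = m := by
        rw [Finset.card_compl, Finset.card_image_of_injOn hφ', Fintype.card_fin]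
      have hc : (insert x D).card = D.card + 1 := Finset.card_insert_of_notMem hx
      have hunfit : ∀ (ρ : Tuple d n) (χ : Fin n → Fin n), exceptional ρ R (2 * Q) ≤ c →
          ((unfit ρ R (2 * Q) D χ).ncard : ℝ) ≤
            (c + (wordBall d (2 * Q)).card * (2 * Q) : ℕ) := fun ρ χ hρ => by
        refine Nat.cast_le.2 ((ncard_unfit_le ρ R (2 * Q) D χ).trans ?_)
        gcongr
        omega
      have key := sum_le_sum_of_forall_notMem (hS.trans hT.symm)
        (a := fun u => (acceptCount σ (.query i fw x next) (insert x D)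
          (Function.update φ x u) : ℝ))
        (b := fun u => (acceptCount τ (.query i fw x next) (insert x D)
          (Function.update φ' x u) : ℝ))
        (F := (m - 1).factorial) (e := k * η * (m - 1).factorial)
        (Set.toFinite (unfit σ R (2 * Q) D φ)) (Set.toFinite (unfit τ R (2 * Q) D φ'))
        (by positivity) (by positivity) (hunfit σ φ hσ) (hunfit τ φ' hτ)
        (fun u hu => by
          refine Nat.cast_le.2 ((Finset.card_filter_le _ _).trans ?_)
          have := (card_extensions _ _ (injOn_update_insert hφ hx (Finset.mem_compl.1 hu))).le
          rwa [hc, ← Nat.sub_sub] at this)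
        (fun _ _ => by positivity)
        (fun u hu v hv hu' hv' => by
          have := acceptCount_query_le_of_mem hη ih (k := k) (by omega)
            (Finset.mem_insert_self x D)
            (injOn_update_insert hφ hx (Finset.mem_compl.1 hu))
            (injOn_update_insert hφ' hx (Finset.mem_compl.1 hv))
            (halike.insert_fit (by omega) hx hu' hv')
            fun ψ hψ => hq ψ ((mem_extensions_insert hx).1 hψ).1
          rwa [hc, ← Nat.sub_sub] at this)
      have hsum : ∀ (ρ : Tuple d n) (χ : Fin n → Fin n),
          (acceptCount ρ (.query i fw x next) D χ : ℝ) = ∑ u ∈ (D.image χ)ᶜ,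
            (acceptCount ρ (.query i fw x next) (insert x D) (Function.update χ x u) : ℝ) :=
        fun ρ χ => by
          rw [acceptCount, card_filter_extensions_eq_sum_vertices D χ hx]
          push_cast
          rfl
      rw [hsum, hsum]
      refine key.trans ?_
      rw [add_assoc]
      gcongr
      have hfact : ((m.factorial : ℕ) : ℝ) = m * (m - 1).factorial := by
        exact_mod_cast (Nat.mul_factorial_pred (by omega)).symm
      have hmn : (n : ℝ) - 2 * Q ≤ m := by
        have : n ≤ m + 2 * Q := by omega
        have : (n : ℝ) ≤ m + 2 * Q := by exact_mod_cast this
        linarith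
      have h1 := hn.trans (mul_le_mul_of_nonneg_left hmn hη)
      have h2 := mul_le_mul_of_nonneg_right h1 (Nat.cast_nonneg (α := ℝ) (m - 1).factorial)
      rw [hS, hfact]
      push_cast at h2 ⊢
      linarith

/-! ### Failure of testability -/

theorem lift_relabel {d n : ℕ} (σ : Tuple d n) (ψ : Equiv.Perm (Fin n)) (w : FreeGroup (Fin d)) :
    FreeGroup.lift (relabel σ ψ) w = ψ⁻¹ * FreeGroup.lift σ w * ψ := by
  have h : FreeGroup.lift (relabel σ ψ) =
      (MulAut.conj ψ⁻¹).toMonoidHom.comp (FreeGroup.lift σ) := by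
    ext1 i
    simp [relabel]
  rw [h]
  simp

theorem relabel_mem_sol {d n : ℕ} {E : EqSystem d} {σ : Tuple d n} (hσ : σ ∈ Sol E n)
    (ψ : Equiv.Perm (Fin n)) : relabel σ ψ ∈ Sol E n := by
  refine mem_sol_iff.2 fun r hr => ?_
  rw [lift_relabel, mem_sol_iff.1 hσ r hr]
  simp

theorem hamming_conj {n : ℕ} (σ τ ψ : Equiv.Perm (Fin n)) :
    hamming (ψ⁻¹ * σ * ψ) τ = hamming σ (ψ * τ * ψ⁻¹) := by
  unfold hamming
  congr 2
  refine Finset.card_bij (fun x _ => ψ x) ?_ (fun _ _ _ _ h => ψ.injective h) ?_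
  · intro x hx
    refine Finset.mem_filter.2 ⟨Finset.mem_univ _, ?_⟩
    simpa [Equiv.symm_apply_eq] using (Finset.mem_filter.1 hx).2
  · intro y hy
    refine ⟨ψ⁻¹ y, ?_, by simp⟩
    refine Finset.mem_filter.2 ⟨Finset.mem_univ _, ?_⟩
    simpa [Equiv.symm_apply_eq] using (Finset.mem_filter.1 hy).2

theorem relabel_mem_solFar {d n : ℕ} {E : EqSystem d} {ε : ℝ} {τ : Tuple d n}
    (hτ : τ ∈ SolFar E ε n) (ψ : Equiv.Perm (Fin n)) : relabel τ ψ ∈ SolFar E ε n := by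
  intro ρ hρ
  refine (hτ _ (relabel_mem_sol hρ ψ⁻¹)).trans (le_of_eq (Finset.sum_congr rfl fun j _ => ?_))
  rw [relabel, relabel, hamming_conj, inv_inv]

theorem Machine.prob_true_add_prob_false {d n : ℕ} (M : Machine d) (σ : Tuple d n) :
    M.prob σ true + M.prob σ false = 1 := by
  have h := ((M n).map fun t => t.run σ).tsum_coe
  rwa [tsum_bool, add_comm] at h

/-- The acceptance probabilities on all relabellings, sorted by the deterministic machine drawn. -/
theorem sum_prob_relabel {d n : ℕ} (M : Machine d) (σ : Tuple d n) :
    ∑ ψ : Equiv.Perm (Fin n), M.prob (relabel σ ψ) true =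
      ∑' t, M n t * (acceptCount σ t ∅ id : ℕ) := by
  classical
  simp only [Machine.prob, PMF.map_apply]
  rw [← Summable.tsum_finsetSum fun _ _ => ENNReal.summable]
  refine tsum_congr fun t => ?_
  have hext : extensions (∅ : Finset (Fin n)) id = Finset.univ := by simp [extensions]
  simp only [acceptCount, hext, eq_comm (a := true)]
  simp [Finset.sum_ite, mul_comm]

theorem not_testable {d : ℕ} {E : EqSystem d} (htau : PropertyTau E)
    (hquot : UnboundedFiniteQuotients (Gam E)) : ¬ Testable E := by
  intro htest
  obtain ⟨ε, hε, hex⟩ := exists_sol_and_solFar_locally_alike htau hquot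
  obtain ⟨q, M, hM⟩ := htest ε hε
  obtain ⟨R, c, hc⟩ := hex (2 * q)
  -- with this `η` the `q` queries account for a difference of at most `1 / 2`
  set η : ℝ := 1 / (2 * (q + 1)) with hη
  have hη0 : 0 < η := by positivity
  have hqη : q * η ≤ 1 / 2 := by
    rw [hη, mul_one_div, div_le_div_iff₀ (by positivity) (by norm_num)]
    linarith
  obtain ⟨n₀, hn₀⟩ := exists_nat_ge
    (2 * ((c + (wordBall d (2 * q)).card * (2 * q) : ℕ) : ℝ) / η + 2 * q)
  obtain ⟨n, hn, σ, hσ, τ, hτ, hσc, hτc⟩ := hc n₀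
  have hn0 : 0 < n := by omega
  have hlarge : 2 * ((c + (wordBall d (2 * q)).card * (2 * q) : ℕ) : ℝ) ≤ η * (n - 2 * q) := by
    have hnn : (n₀ : ℝ) ≤ n := by exact_mod_cast hn.le
    have h := (le_sub_iff_add_le.2 (hn₀.trans hnn))
    rw [div_le_iff₀ hη0] at h
    linarith
  have hcount : ∀ t ∈ (M n).support,
      2 * acceptCount σ t ∅ id ≤ 2 * acceptCount τ t ∅ id + n.factorial := by
    intro t ht
    have h := acceptsAlike hη0.le hσc hτc hlarge t q ∅ id id (by simp) (by simp) (by simp)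
      (fun _ _ x hx => absurd hx (Finset.notMem_empty x))
      fun ψ _ => hM.query_efficiency n hn0 t ht _
    rw [Finset.card_empty, Nat.sub_zero] at h
    have h2 := mul_le_mul_of_nonneg_right hqη (Nat.cast_nonneg (α := ℝ) n.factorial)
    have h3 : 2 * (acceptCount σ t ∅ id : ℝ) ≤ 2 * acceptCount τ t ∅ id + n.factorial := by
      linarith
    exact_mod_cast h3
  have hsum : 2 * ∑ ψ : Equiv.Perm (Fin n), M.prob (relabel σ ψ) true ≤
      2 * ∑ ψ : Equiv.Perm (Fin n), M.prob (relabel τ ψ) true + n.factorial := by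
    rw [sum_prob_relabel, sum_prob_relabel, ← ENNReal.tsum_mul_left, ← ENNReal.tsum_mul_left]
    calc _ ≤ ∑' t, (2 * (M n t * (acceptCount τ t ∅ id : ℕ)) + M n t * n.factorial) := by
          refine ENNReal.tsum_le_tsum fun t => ?_
          by_cases ht : t ∈ (M n).support
          · have h : ((2 * acceptCount σ t ∅ id : ℕ) : ℝ≥0∞) ≤
                ((2 * acceptCount τ t ∅ id + n.factorial : ℕ) : ℝ≥0∞) :=
              Nat.cast_le.2 (hcount t ht)
            push_cast at h
            calc _ = M n t * (2 * (acceptCount σ t ∅ id : ℕ)) := by ring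
              _ ≤ M n t * (2 * (acceptCount τ t ∅ id : ℕ) + n.factorial) := by gcongr
              _ = _ := by ring
          · rw [PMF.apply_eq_zero_iff _ _ |>.2 ht]
            simp
      _ = _ := by rw [ENNReal.tsum_add, ENNReal.tsum_mul_right, PMF.tsum_coe, one_mul]
  have hfin : ∀ (ρ : Tuple d n) (b : Bool), M.prob ρ b ≠ ∞ := fun ρ b => PMF.apply_ne_top _ _
  have hsumR : 2 * ∑ ψ : Equiv.Perm (Fin n), (M.prob (relabel σ ψ) true).toReal ≤
      2 * ∑ ψ : Equiv.Perm (Fin n), (M.prob (relabel τ ψ) true).toReal + n.factorial := by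
    have hne : ∀ ρ : Tuple d n, ∑ ψ : Equiv.Perm (Fin n), M.prob (relabel ρ ψ) true ≠ ∞ :=
      fun ρ => ENNReal.sum_ne_top.2 fun ψ _ => hfin _ _
    have h := ENNReal.toReal_mono (ENNReal.add_ne_top.2
      ⟨ENNReal.mul_ne_top (by simp) (hne τ), by simp⟩) hsum
    rw [ENNReal.toReal_add (ENNReal.mul_ne_top (by simp) (hne τ)) (by simp), ENNReal.toReal_mul,
      ENNReal.toReal_mul, ENNReal.toReal_sum fun ψ _ => hfin _ _,
      ENNReal.toReal_sum fun ψ _ => hfin _ _, ENNReal.toReal_natCast] at h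
    simpa using h
  have hge : ∀ (ρ : Tuple d n) (b : Bool), 99 / 100 ≤ M.prob ρ b →
      99 / 100 ≤ (M.prob ρ b).toReal := fun ρ b h => by
    simpa using ENNReal.toReal_mono (hfin ρ b) h
  have hlow : ∑ _ψ : Equiv.Perm (Fin n), (99 / 100 : ℝ) ≤
      ∑ ψ : Equiv.Perm (Fin n), (M.prob (relabel σ ψ) true).toReal :=
    Finset.sum_le_sum fun ψ _ => hge _ _ (hM.completeness n hn0 _ (relabel_mem_sol hσ ψ))
  have hupp : ∑ ψ : Equiv.Perm (Fin n), (M.prob (relabel τ ψ) true).toReal ≤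
      ∑ _ψ : Equiv.Perm (Fin n), (1 / 100 : ℝ) := by
    refine Finset.sum_le_sum fun ψ _ => ?_
    have h1 := hge _ _ (hM.soundness n hn0 _ (relabel_mem_solFar hτ ψ))
    have h2 := congrArg ENNReal.toReal (M.prob_true_add_prob_false (relabel τ ψ))
    rw [ENNReal.toReal_add (hfin _ _) (hfin _ _), ENNReal.toReal_one] at h2
    linarith
  rw [Finset.sum_const, Finset.card_univ, Fintype.card_perm, Fintype.card_fin, nsmul_eq_mul]
    at hlow hupp
  have hpos : (0 : ℝ) < n.factorial := by exact_mod_cast n.factorial_pos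
  linarith

/-! ### Failure of statistical distinguishability -/

theorem localDist_le {d n L : ℕ} {P : Finset (FreeGroup (Fin d))} (hP : P ⊆ wordBall d L)
    (R : Set (FreeGroup (Fin d))) (σ τ : Tuple d n) :
    localDist P σ τ ≤ ((exceptional σ R L : ℝ) + exceptional τ R L) / n := by
  classical
  set Q₀ := P.filter (· ∈ R) with hQ₀
  have hloc : ∀ (ρ : Tuple d n) (x : Fin n), LocallyLike ρ R L x → stabIn ρ P x = Q₀ :=
    fun ρ x hx => Finset.filter_congr fun w hw => hx w (mem_wordBall.1 (hP hw))
  -- the unnormalized distance to the point mass at `Q₀`, summed over the points one by one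
  have hone : ∀ ρ : Tuple d n, ∑ Q ∈ P.powerset,
      |((Finset.univ.filter fun x => stabIn ρ P x = Q).card : ℝ) - if Q = Q₀ then (n : ℝ) else 0| ≤
      2 * exceptional ρ R L := by
    intro ρ
    have hpt : ∀ Q, |((Finset.univ.filter fun x => stabIn ρ P x = Q).card : ℝ) -
        if Q = Q₀ then (n : ℝ) else 0| ≤ ∑ x : Fin n,
          |(if stabIn ρ P x = Q then (1 : ℝ) else 0) - if Q = Q₀ then 1 else 0| := by
      intro Q
      refine le_trans (le_of_eq ?_) (Finset.abs_sum_le_sum_abs _ _)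
      rw [Finset.sum_sub_distrib, Finset.sum_boole, Finset.sum_const, Finset.card_univ,
        Fintype.card_fin, nsmul_eq_mul, mul_ite, mul_one, mul_zero]
    refine (Finset.sum_le_sum fun Q _ => hpt Q).trans ?_
    rw [Finset.sum_comm]
    have hx : ∀ x : Fin n, ∑ Q ∈ P.powerset,
        |(if stabIn ρ P x = Q then (1 : ℝ) else 0) - if Q = Q₀ then 1 else 0| ≤
        if LocallyLike ρ R L x then 0 else 2 := by
      intro x
      split_ifs with h
      · refine le_of_eq (Finset.sum_eq_zero fun Q _ => ?_)
        simp [hloc ρ x h, eq_comm]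
      · calc _ ≤ ∑ Q ∈ P.powerset, ((if stabIn ρ P x = Q then (1 : ℝ) else 0) +
              if Q = Q₀ then 1 else 0) := by
              refine Finset.sum_le_sum fun Q _ => ?_
              split_ifs <;> norm_num
          _ ≤ 2 := by
              rw [Finset.sum_add_distrib, Finset.sum_ite_eq, Finset.sum_ite_eq']
              split_ifs <;> norm_num
    refine (Finset.sum_le_sum fun x _ => hx x).trans (le_of_eq ?_)
    rw [exceptional, ← Finset.sum_filter_add_sum_filter_not Finset.univ (LocallyLike ρ R L),
      Finset.sum_congr rfl fun x hx => if_pos (Finset.mem_filter.1 hx).2,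
      Finset.sum_congr rfl fun x hx => if_neg (Finset.mem_filter.1 hx).2]
    simp [mul_comm]
  have hsum : ∑ Q ∈ P.powerset, |localStat σ P Q - localStat τ P Q| ≤
      (2 * exceptional σ R L + 2 * exceptional τ R L) / n := by
    refine le_trans ?_ (div_le_div_of_nonneg_right (add_le_add (hone σ) (hone τ)) n.cast_nonneg)
    rw [← Finset.sum_add_distrib, Finset.sum_div]
    refine Finset.sum_le_sum fun Q _ => ?_
    rw [localStat, localStat, ← sub_div, abs_div, Nat.abs_cast]
    refine div_le_div_of_nonneg_right ?_ n.cast_nonneg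
    rw [abs_sub_comm ((Finset.univ.filter fun x => stabIn τ P x = Q).card : ℝ)]
    exact abs_sub_le _ _ _
  rw [localDist]
  refine (mul_le_mul_of_nonneg_left hsum (by norm_num)).trans (le_of_eq ?_)
  ring

theorem not_statDistinguishable {d : ℕ} {E : EqSystem d} (htau : PropertyTau E)
    (hquot : UnboundedFiniteQuotients (Gam E)) : ¬ StatDistinguishable E := by
  intro hstat
  obtain ⟨ε, hε, hex⟩ := exists_sol_and_solFar_locally_alike htau hquot
  obtain ⟨P, δ, hδ, hP⟩ := hstat ε hε
  have hPL : P ⊆ wordBall d (P.sup FreeGroup.norm) := fun w hw =>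
    mem_wordBall.2 (Finset.le_sup hw)
  obtain ⟨R, c, hc⟩ := hex (P.sup FreeGroup.norm)
  obtain ⟨n₀, hn₀⟩ := exists_nat_ge (2 * c / δ)
  obtain ⟨n, hn, σ, hσ, τ, hτ, hσc, hτc⟩ := hc n₀
  have h := (hP n (by omega) σ hσ τ hτ).trans (localDist_le hPL R σ τ)
  have hn' : (n₀ : ℝ) < n := by exact_mod_cast hn
  have hn0 : (0 : ℝ) < n := n₀.cast_nonneg.trans_lt hn'
  rw [le_div_iff₀ hn0] at h
  rw [div_le_iff₀ hδ] at hn₀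
  have h1 : (exceptional σ R (P.sup FreeGroup.norm) : ℝ) ≤ c := by exact_mod_cast hσc
  have h2 : (exceptional τ R (P.sup FreeGroup.norm) : ℝ) ≤ c := by exact_mod_cast hτc
  nlinarith

end PermEq

end

theorem theorem1p7 {d : ℕ} (E : PermEq.EqSystem d)
    (htau : PermEq.PropertyTau E)
    (hquot : PermEq.UnboundedFiniteQuotients (PermEq.Gam E)) :
    ¬ PermEq.Testable E ∧ ¬ PermEq.StatDistinguishable E :=
  ⟨PermEq.not_testable htau hquot, PermEq.not_statDistinguishable htau hquot⟩
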